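/- Let $p\ge 1$ be an integer. For a finite word $(a_1,\dots,a_m)$ of nonnegative integers let $\mathrm{asc}(a_1,\dots,a_m)=|\{j : 1\le j<m,\ a_j<a_{j+1}\}|$ be its number of ascents. A word $w=(a_1,\dots,a_m)$ is a $p$-ascent sequence if $m=0$ (the empty word), or if $a_1=0$ and $0\le a_i\le p+\mathrm{asc}(a_1,\dots,a_{i-1})$ for all $2\le i\le m$. Let $\mathrm{Asc}(p)$ be the set of all $p$-ascent sequences, and for $w\in\mathrm{Asc}(p)$ let $|w|$ be its length and $|w|_0$ the number of its letters equal to $0$. Then, in the ring $\mathbb{Z}[[t,z]]$ of formal power series, the two infinite sums below (over $w$ and over $n$) converge coefficientwise, and $$A^{(p)}(t,z):=\sum_{w\in \mathrm{Asc}(p)} t^{|w|}z^{|w|_0}=1+\sum_{n\ge 0}\binom{p-1+n}{n}\frac{zt}{(1-zt)^{n+1}}\prod_{i=1}^{n}\bigl(1-(1-t)^i\bigr).$$ -/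

import Mathlib

open scoped MvPowerSeries.WithPiTopology

namespace PAscent

/-- The number of ascents of a word `(a_1, …, a_m)`, i.e. the number of positions `j` with
`1 ≤ j < m` and `a_j < a_{j+1}` (positions are counted from `0` in the code). -/
def asc (w : List ℕ) : ℕ :=
  ((Finset.range (w.length - 1)).filter fun j => w.getD j 0 < w.getD (j + 1) 0).card

/-- A word `(a_1, …, a_m)` over the natural numbers is a `p`-ascent sequence if its first letter
is `0` and every later letter satisfies `a_i ≤ p + asc (a_1, …, a_{i-1})`. The empty word is a
`p`-ascent sequence. (Positions are counted from `0` in the code.) -/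
def IsPAscentSeq (p : ℕ) (w : List ℕ) : Prop :=
  ∀ (i : ℕ) (hi : i < w.length),
    (i = 0 → w[i] = 0) ∧ (1 ≤ i → w[i] ≤ p + asc (w.take i))

/-- The ring `ℤ⟦t, z⟧` of formal power series in two commuting variables. Infinite sums in it are
taken in the topology of coefficientwise convergence, with `ℤ` discrete. -/
abbrev Series : Type := MvPowerSeries (Fin 2) ℤ

/-- The variable that marks the length. -/
noncomputable def t : Series := MvPowerSeries.X 0

/-- The variable that marks the number of zeros. -/
noncomputable def z : Series := MvPowerSeries.X 1

/-- The formal power series `1 / (1 - z t)`. -/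
noncomputable def invOneSubZT : Series := MvPowerSeries.invOfUnit (1 - z * t) 1

theorem one_sub_zt_mul_inv : (1 - z * t) * invOneSubZT = 1 := by
  apply MvPowerSeries.mul_invOfUnit
  simp [z, t]

/-- The monomial `t^{|w|} z^{|w|_0}` of a `p`-ascent sequence `w`. -/
noncomputable def weight (p : ℕ) (w : {w : List ℕ // IsPAscentSeq p w}) : Series :=
  t ^ w.1.length * z ^ w.1.count 0

/-- The generating function of the `p`-ascent sequences by length and number of zeros. -/
noncomputable def A (p : ℕ) : Series := ∑' w, weight p w

/-- The term `binom(p-1+n, n) * z t / (1 - z t)^(n+1) * ∏_{i=1}^n (1 - (1-t)^i)`, for `p ≥ 1`. -/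
noncomputable def term (p n : ℕ) : Series :=
  ((p - 1 + n).choose n : Series) * (z * t * invOneSubZT ^ (n + 1)) *
    ∏ i ∈ Finset.Icc 1 n, (1 - (1 - t) ^ i)

end PAscent

namespace PAscent

open Finset

/-! ### Explicit series solving the continuation recursion -/

section Functional

open PowerSeries

/-! Let F(m,l) be the generating function of continuations of a word with last letter l and largest
admissible next letter m. Choosing the next letter gives the recursion `contSeries_eq`, whose factor
t makes its solution unique. With q = 1 - t, the solution is the image of (1-x)^{-(m-l)} (1-qx)^{-l}
under the linear map x^n ↦ `qCoeff n`. Terms from ascents telescope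
(`t_smul_kernelSeries_succ_succ`), leaving an identity free of l, `contSeries_self`; this is the
q-difference equation `umbral_eq_of_X_mul_eq` for (1-x)^{-m}. Nonempty sequences start with 0, so A
= 1 + zt F(p,0), and expanding (1-x)^{-p} yields the binomials. -/

/-- The coefficient `∏_{i=1}^n (1 - (1-t)^i) / (1 - z t)^(n+1)`. -/
noncomputable def qCoeff (n : ℕ) : Series :=
  invOneSubZT ^ (n + 1) * ∏ i ∈ Icc 1 n, (1 - (1 - t) ^ i)

theorem one_sub_zt_mul_qCoeff_zero : (1 - z * t) * qCoeff 0 = 1 := by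
  simpa [qCoeff] using one_sub_zt_mul_inv

theorem one_sub_zt_mul_qCoeff_succ (n : ℕ) :
    (1 - z * t) * qCoeff (n + 1) = (1 - (1 - t) ^ (n + 1)) * qCoeff n := by
  rw [qCoeff, qCoeff, prod_Icc_succ_top (Nat.le_add_left 1 n)]
  linear_combination (invOneSubZT ^ (n + 1) * (∏ i ∈ Icc 1 n, (1 - (1 - t) ^ i)) *
    (1 - (1 - t) ^ (n + 1))) * one_sub_zt_mul_inv

/-- Each factor 1 - (1-t)^i is divisible by t; this makes every sum against `qCoeff` converge. -/
theorem t_pow_dvd_qCoeff (n : ℕ) : t ^ n ∣ qCoeff n := by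
  refine Dvd.dvd.mul_left ?_ _
  have h : ∏ _i ∈ Icc 1 n, t ∣ ∏ i ∈ Icc 1 n, (1 - (1 - t) ^ i) :=
    prod_dvd_prod_of_dvd _ _ fun i _ => by simpa using sub_dvd_pow_sub_pow 1 (1 - t) i
  simpa using h

theorem coeff_eq_zero_of_t_pow_dvd {n : ℕ} {f : Series} (h : t ^ n ∣ f) {d : Fin 2 →₀ ℕ}
    (hd : d 0 < n) : MvPowerSeries.coeff d f = 0 :=
  MvPowerSeries.X_pow_dvd_iff.1 h d hd

theorem summable_of_t_pow_dvd {f : ℕ → Series} (h : ∀ n, t ^ n ∣ f n) : Summable f := by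
  refine MvPowerSeries.WithPiTopology.summable_iff_summable_coeff.2 fun d => ?_
  refine summable_of_ne_finset_zero (s := range (d 0 + 1)) fun n hn => ?_
  rw [mem_range] at hn
  exact coeff_eq_zero_of_t_pow_dvd (h n) (by lia)

theorem summable_mul_qCoeff (f : ℕ → Series) : Summable fun n => f n * qCoeff n :=
  summable_of_t_pow_dvd fun n => (t_pow_dvd_qCoeff n).mul_left _

/-- The linear functional on power series over `ℤ⟦t, z⟧` that sends `x ^ n` to `qCoeff n`. -/
noncomputable def umbral : PowerSeries Series →ₗ[Series] Series where
  toFun h := ∑' n, PowerSeries.coeff n h * qCoeff n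
  map_add' h k := by
    rw [← (summable_mul_qCoeff _).tsum_add (summable_mul_qCoeff _)]
    simp [add_mul]
  map_smul' c h := by
    simp only [map_smul, smul_eq_mul, mul_assoc, RingHom.id_apply]
    exact (summable_mul_qCoeff _).tsum_mul_left c

theorem umbral_apply (h : PowerSeries Series) :
    umbral h = ∑' n, PowerSeries.coeff n h * qCoeff n := rfl

/-- The `q`-difference equation satisfied by `umbral`, with `q = 1 - t`. -/
theorem umbral_eq_of_X_mul_eq {h k : PowerSeries Series}
    (hk : X * k = h - rescale (1 - t) h) :
    umbral k = (1 - z * t) * umbral h - PowerSeries.coeff 0 h := by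
  -- Passing from h to h - h(qx) multiplies the coefficient of x^(n+1) by 1 - q^(n+1), exactly the
  -- factor in the recurrence of `qCoeff`.
  have hc (n : ℕ) : PowerSeries.coeff n k * qCoeff n =
      (1 - z * t) * (PowerSeries.coeff (n + 1) h * qCoeff (n + 1)) := by
    have := congrArg (PowerSeries.coeff (n + 1)) hk
    rw [coeff_succ_X_mul, map_sub, coeff_rescale] at this
    rw [this]
    linear_combination -PowerSeries.coeff (n + 1) h * one_sub_zt_mul_qCoeff_succ n
  have hs : Summable fun n => PowerSeries.coeff (n + 1) h * qCoeff (n + 1) :=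
    summable_of_t_pow_dvd fun n =>
      ((pow_dvd_pow t n.le_succ).trans (t_pow_dvd_qCoeff (n + 1))).mul_left _
  rw [umbral_apply, umbral_apply,
    (summable_mul_qCoeff fun n => PowerSeries.coeff n h).tsum_eq_zero_add, tsum_congr hc,
    hs.tsum_mul_left]
  linear_combination -PowerSeries.coeff 0 h * one_sub_zt_mul_qCoeff_zero

/-- The power series `(1 - x)^{-(m-l)} (1 - (1-t) x)^{-l}`. -/
noncomputable def kernelSeries (m l : ℕ) : PowerSeries Series :=
  (PowerSeries.mk 1) ^ (m - l) * (rescale (1 - t) (PowerSeries.mk 1)) ^ l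

theorem one_sub_mul_rescale_mk_one :
    rescale (1 - t) (PowerSeries.mk 1 : PowerSeries Series) * (1 - C (1 - t) * X) = 1 := by
  have := congrArg (rescale (1 - t)) (mk_one_mul_one_sub_eq_one Series)
  simpa only [map_mul, map_sub, map_one, rescale_X] using this

/-- After clearing denominators, this is (1-qx) - (1-x) = tx. -/
theorem t_smul_kernelSeries_succ_succ {m l : ℕ} (h : l < m) :
    t • kernelSeries (m + 1) (l + 1) =
      t • kernelSeries m (l + 1) + (kernelSeries m l - kernelSeries m (l + 1)) := by
  obtain ⟨d, rfl⟩ := Nat.exists_eq_add_of_lt h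
  have hu := mk_one_mul_one_sub_eq_one Series
  have hv := one_sub_mul_rescale_mk_one
  simp only [kernelSeries, smul_eq_C_mul, show l + d + 1 + 1 - (l + 1) = d + 1 by lia,
    show l + d + 1 - (l + 1) = d by lia, show l + d + 1 - l = d + 1 by lia]
  generalize (PowerSeries.mk 1 : PowerSeries Series) = u at *
  generalize rescale (1 - t) u = v at *
  simp only [map_sub, map_one] at hv
  linear_combination (u ^ d * v ^ l) * (u * hv - (1 - C t) * v * hu)

theorem X_mul_t_smul_kernelSeries_succ {m l : ℕ} (h : l < m) :
    X * (t • kernelSeries m (l + 1)) =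
      (1 - X) * (kernelSeries m l - kernelSeries m (l + 1)) := by
  obtain ⟨d, rfl⟩ := Nat.exists_eq_add_of_lt h
  have hu := mk_one_mul_one_sub_eq_one Series
  have hv := one_sub_mul_rescale_mk_one
  simp only [kernelSeries, smul_eq_C_mul,
    show l + d + 1 - (l + 1) = d by lia, show l + d + 1 - l = d + 1 by lia]
  generalize (PowerSeries.mk 1 : PowerSeries Series) = u at *
  generalize rescale (1 - t) u = v at *
  simp only [map_sub, map_one] at hv
  linear_combination (u ^ d * v ^ l) * (hv - hu)

/-- The sum telescopes, and x ↦ qx turns (1-x)^{-m} into (1-qx)^{-m}. -/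
theorem X_mul_sum_kernelSeries (m : ℕ) :
    X * ((∑ a ∈ range m, t • kernelSeries m (a + 1)) + kernelSeries m 0 - kernelSeries m m) =
      kernelSeries m 0 - rescale (1 - t) (kernelSeries m 0) := by
  have h : X * ∑ a ∈ range m, t • kernelSeries m (a + 1) =
      (1 - X) * (kernelSeries m 0 - kernelSeries m m) := by
    rw [mul_sum, sum_congr rfl fun a ha => X_mul_t_smul_kernelSeries_succ (mem_range.1 ha),
      ← mul_sum, sum_range_sub']
  have h' : rescale (1 - t) (kernelSeries m 0) = kernelSeries m m := by simp [kernelSeries]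
  rw [h']
  linear_combination h

/-- The generating function of the continuations of a word with last letter `l` for which the
next letter may be at most `m`. -/
noncomputable def contSeries (m l : ℕ) : Series := umbral (kernelSeries m l)

theorem t_mul_contSeries_succ_succ {m l : ℕ} (h : l < m) :
    t * contSeries (m + 1) (l + 1) =
      t * contSeries m (l + 1) + (contSeries m l - contSeries m (l + 1)) := by
  simpa [contSeries] using congrArg umbral (t_smul_kernelSeries_succ_succ h)

theorem contSeries_self (m : ℕ) :
    contSeries m m = 1 + z * t * contSeries m 0 + ∑ a ∈ range m, t * contSeries m (a + 1) := by
  have h := umbral_eq_of_X_mul_eq (X_mul_sum_kernelSeries m)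
  have h0 : PowerSeries.coeff 0 (kernelSeries m 0) = 1 := by simp [kernelSeries]
  simp only [map_sub, map_add, map_sum, map_smul, smul_eq_mul, h0] at h
  simp only [contSeries]
  linear_combination -h

theorem sum_range_ite_sub {M : Type*} [AddCommGroup M] (f : ℕ → M) {l m : ℕ} (h : l ≤ m) :
    ∑ a ∈ range m, (if l ≤ a then f a - f (a + 1) else 0) = f l - f m := by
  induction m, h using Nat.le_induction with
  | base =>
    rw [sub_self]
    exact sum_eq_zero fun a ha => if_neg (by simpa using ha)
  | succ m hm ih => simp [sum_range_succ, ih, hm]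

/-- The weight of a letter: `z` for a zero and `1` otherwise. -/
noncomputable def letterWeight (a : ℕ) : Series := if a = 0 then z else 1

theorem contSeries_eq {m l : ℕ} (h : l ≤ m) :
    contSeries m l = 1 + t * ∑ a ∈ range (m + 1),
      letterWeight a * contSeries (if l < a then m + 1 else m) a := by
  -- Each letter above l contributes an extra difference; these sum to F(m,l) - F(m,m).
  have h1 : ∀ a ∈ range m, t * contSeries (if l < a + 1 then m + 1 else m) (a + 1) =
      t * contSeries m (a + 1) +
        if l ≤ a then contSeries m a - contSeries m (a + 1) else 0 := by
    intro a ha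
    rw [mem_range] at ha
    by_cases hl : l ≤ a
    · simp [hl, Nat.lt_succ_of_le hl, t_mul_contSeries_succ_succ ha]
    · simp [hl]
  rw [sum_range_succ', mul_add, mul_sum]
  simp only [letterWeight, Nat.add_eq_zero_iff, one_ne_zero, and_false, if_false, one_mul, if_true,
    not_lt_zero]
  rw [sum_congr rfl h1, sum_add_distrib, sum_range_ite_sub _ h]
  linear_combination contSeries_self m

theorem z_mul_t_mul_contSeries_eq_tsum {p : ℕ} (hp : 1 ≤ p) :
    z * t * contSeries p 0 = ∑' n, term p n := by
  rw [contSeries, umbral_apply, ← (summable_mul_qCoeff _).tsum_mul_left]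
  refine tsum_congr fun n => ?_
  obtain ⟨d, rfl⟩ := Nat.exists_eq_add_of_le' hp
  simp only [kernelSeries, Nat.sub_zero, pow_zero, mul_one, mk_one_pow_eq_mk_choose_add,
    PowerSeries.coeff_mk, term, qCoeff, Nat.add_sub_cancel, Nat.choose_symm_add]
  ring

theorem summable_term (p : ℕ) : Summable (term p) := by
  refine (summable_mul_qCoeff fun n => ((p - 1 + n).choose n : Series) * (z * t)).congr fun n => ?_
  simp only [term, qCoeff]
  ring

end Functional

/-! ### Words and their generating function -/

section Words

/-- The words `w` of length `k` that continue a word with last letter `l` for which the next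
letter may be at most `m`. -/
def contWords : ℕ → ℕ → ℕ → Finset (List ℕ)
  | _, _, 0 => {[]}
  | m, l, k + 1 => (range (m + 1)).biUnion fun a =>
      (contWords (if l < a then m + 1 else m) a k).image (List.cons a)

theorem length_of_mem_contWords {k : ℕ} : ∀ {m l : ℕ} {w : List ℕ}, w ∈ contWords m l k →
    w.length = k := by
  induction k with
  | zero => simp [contWords]
  | succ k ih =>
    intro m l w hw
    simp only [contWords, mem_biUnion, mem_image] at hw
    obtain ⟨a, -, v, hv, rfl⟩ := hw
    simp [ih hv]

theorem cons_mem_contWords {m l a : ℕ} {w : List ℕ} :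
    a :: w ∈ contWords m l (a :: w).length ↔
      a ≤ m ∧ w ∈ contWords (if l < a then m + 1 else m) a w.length := by
  simp only [List.length_cons, contWords, mem_biUnion, mem_image, mem_range, Nat.lt_succ_iff]
  constructor
  · rintro ⟨b, hb, v, hv, h⟩
    obtain ⟨rfl, rfl⟩ := List.cons.inj h
    exact ⟨hb, hv⟩
  · rintro ⟨ha, hw⟩
    exact ⟨a, ha, w, hw, rfl⟩

theorem sum_contWords_succ {M : Type*} [AddCommMonoid M] (m l k : ℕ) (f : List ℕ → M) :
    ∑ w ∈ contWords m l (k + 1), f w = ∑ a ∈ range (m + 1),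
      ∑ w ∈ contWords (if l < a then m + 1 else m) a k, f (a :: w) := by
  rw [contWords, sum_biUnion]
  · exact sum_congr rfl fun a _ => sum_image fun _ _ _ _ h => List.cons_injective h
  · intro a _ b _ hab
    refine disjoint_left.2 fun w hw hw' => ?_
    simp only [mem_image] at hw hw'
    obtain ⟨v, -, rfl⟩ := hw
    obtain ⟨v', -, h⟩ := hw'
    exact hab (List.cons.inj h).1.symm

/-- The weight `t^{|w|} z^{|w|_0}` of a word. -/
noncomputable def wordWeight (w : List ℕ) : Series := t ^ w.length * z ^ w.count 0

theorem wordWeight_cons (a : ℕ) (w : List ℕ) :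
    wordWeight (a :: w) = t * (letterWeight a * wordWeight w) := by
  by_cases ha : a = 0 <;> simp [wordWeight, letterWeight, ha, pow_succ] <;> ring

/-- Both sides obey the same recursion, and each letter read gains a factor t. -/
theorem t_pow_dvd_contSeries_sub (N : ℕ) : ∀ {m l : ℕ}, l ≤ m →
    t ^ N ∣ contSeries m l - ∑ k ∈ range N, ∑ w ∈ contWords m l k, wordWeight w := by
  induction N with
  | zero => simp
  | succ N ih =>
    intro m l h
    have hs : ∑ k ∈ range (N + 1), ∑ w ∈ contWords m l k, wordWeight w =
        1 + t * ∑ a ∈ range (m + 1), letterWeight a * ∑ k ∈ range N,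
          ∑ w ∈ contWords (if l < a then m + 1 else m) a k, wordWeight w := by
      simp only [sum_range_succ' _ N, sum_contWords_succ, wordWeight_cons, mul_sum]
      rw [sum_comm, add_comm]
      simp [contWords, wordWeight]
    rw [contSeries_eq h, hs, add_sub_add_left_eq_sub, ← mul_sub, ← sum_sub_distrib, pow_succ']
    refine mul_dvd_mul_left _ (dvd_sum fun a ha => ?_)
    rw [← mul_sub]
    refine (ih ?_).mul_left _
    rw [mem_range, Nat.lt_succ_iff] at ha
    split_ifs <;> lia

theorem asc_append_pair (u : List ℕ) (l a : ℕ) :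
    asc (u ++ [l] ++ [a]) = asc (u ++ [l]) + if l < a then 1 else 0 := by
  have h : ∀ j ∈ range u.length,
      ((u ++ [l] ++ [a]).getD j 0 < (u ++ [l] ++ [a]).getD (j + 1) 0 ↔
        (u ++ [l]).getD j 0 < (u ++ [l]).getD (j + 1) 0) := by
    intro j hj
    rw [mem_range] at hj
    rw [List.getD_append (u ++ [l]) _ _ _ (by simp; lia),
      List.getD_append (u ++ [l]) _ _ _ (by simp; lia)]
  simp only [asc, List.length_append, List.length_singleton, Nat.add_sub_cancel]
  rw [range_add_one, filter_insert, filter_congr h]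
  have h1 : (u ++ [l] ++ [a]).getD u.length 0 = l := by simp
  have h2 : (u ++ [l] ++ [a]).getD (u.length + 1) 0 = a := by simp [List.getD]
  rw [h1, h2]
  split_ifs
  · rw [card_insert_of_notMem (by simp)]
  · simp

/-- The prefix is kept general so that the induction can move letters into it. -/
theorem mem_contWords_iff (p : ℕ) (w : List ℕ) : ∀ (u : List ℕ) (l : ℕ),
    w ∈ contWords (p + asc (u ++ [l])) l w.length ↔
      ∀ (i : ℕ) (hi : i < (u ++ [l] ++ w).length), u.length + 1 ≤ i →
        (u ++ [l] ++ w)[i] ≤ p + asc ((u ++ [l] ++ w).take i) := by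
  induction w with
  | nil =>
    intro u l
    simp [contWords]
    lia
  | cons a w ih =>
    intro u l
    have hm : (if l < a then p + asc (u ++ [l]) + 1 else p + asc (u ++ [l])) =
        p + asc (u ++ [l] ++ [a]) := by
      rw [asc_append_pair]; split_ifs <;> lia
    have hw : u ++ [l] ++ a :: w = u ++ [l] ++ [a] ++ w := by simp
    rw [cons_mem_contWords, hm, ih (u ++ [l]) a]
    simp only [hw, List.length_append, List.length_singleton]
    have h0 : (u ++ [l] ++ [a] ++ w)[u.length + 1]'(by simp) = a := by simp
    have h1 : (u ++ [l] ++ [a] ++ w).take (u.length + 1) = u ++ [l] := by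
      rw [List.append_assoc (u ++ [l])]
      exact List.take_left' (by simp)
    constructor
    · rintro ⟨ha, h⟩ i hi hui
      rcases hui.eq_or_lt with rfl | hlt
      · rwa [h0, h1]
      · exact h i hi hlt
    · refine fun h => ⟨?_, fun i hi hui => h i hi (by lia)⟩
      have := h (u.length + 1) (by lia) le_rfl
      rwa [h0, h1] at this

theorem isPAscentSeq_nil (p : ℕ) : IsPAscentSeq p [] := fun i hi => absurd hi (by simp)

theorem isPAscentSeq_cons {p a : ℕ} {w : List ℕ} :
    IsPAscentSeq p (a :: w) ↔ a = 0 ∧ w ∈ contWords p 0 w.length := by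
  have h := mem_contWords_iff p w [] 0
  simp only [List.nil_append, show asc [0] = 0 from rfl, Nat.add_zero, List.singleton_append,
    List.length_nil, Nat.zero_add] at h
  rw [h]
  constructor
  · intro hw
    obtain rfl : a = 0 := (hw 0 (by simp)).1 rfl
    exact ⟨rfl, fun i hi hi1 => (hw i hi).2 hi1⟩
  · rintro ⟨rfl, hw⟩ i hi
    exact ⟨fun h0 => by subst h0; rfl, hw i hi⟩

theorem hasSum_weight (p : ℕ) : HasSum (weight p) (1 + z * t * contSeries p 0) := by
  refine MvPowerSeries.WithPiTopology.hasSum_iff_hasSum_coeff.2 fun d => ?_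
  set f : List ℕ → ℤ := fun w => MvPowerSeries.coeff d (wordWeight w) with hf
  change HasSum (f ∘ ((↑) : {w | IsPAscentSeq p w} → List ℕ)) _
  rw [hasSum_subtype_iff_indicator]
  -- T holds the tails after the leading 0; longer tails have t-degree above d 0.
  set T : Finset (List ℕ) := (range (d 0 + 1)).biUnion (contWords p 0) with hT
  have hmem (w : List ℕ) : w ∈ T ↔ w.length ≤ d 0 ∧ w ∈ contWords p 0 w.length := by
    simp only [hT, mem_biUnion, mem_range, Nat.lt_succ_iff]
    constructor
    · rintro ⟨k, hk, hw⟩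
      rw [length_of_mem_contWords hw]
      exact ⟨hk, hw⟩
    · rintro ⟨hk, hw⟩
      exact ⟨_, hk, hw⟩
  set S : Finset (List ℕ) := insert [] (T.image (List.cons 0)) with hS
  have hzero : ∀ w ∉ S, Set.indicator {w | IsPAscentSeq p w} f w = 0 := by
    intro w hw
    refine Set.indicator_apply_eq_zero.2 fun hp => ?_
    cases w with
    | nil => simp [hS] at hw
    | cons a v =>
      obtain ⟨rfl, hv⟩ := isPAscentSeq_cons.1 hp
      have hlen : d 0 < v.length := by
        by_contra! hle
        exact hw (mem_insert_of_mem (mem_image_of_mem _ ((hmem v).2 ⟨hle, hv⟩)))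
      refine coeff_eq_zero_of_t_pow_dvd (n := (0 :: v).length) (Dvd.intro _ rfl) ?_
      rw [List.length_cons]
      lia
  have hsum : ∑ w ∈ S, Set.indicator {w | IsPAscentSeq p w} f w =
      MvPowerSeries.coeff d (1 + z * t * contSeries p 0) := by
    have hS' : ∀ w ∈ S, IsPAscentSeq p w := by
      intro w hw
      rcases mem_insert.1 hw with rfl | hw
      · exact isPAscentSeq_nil p
      · obtain ⟨v, hv, rfl⟩ := mem_image.1 hw
        exact isPAscentSeq_cons.2 ⟨rfl, ((hmem v).1 hv).2⟩
    have hTsum : ∑ w ∈ T, wordWeight w =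
        ∑ k ∈ range (d 0 + 1), ∑ w ∈ contWords p 0 k, wordWeight w := by
      refine sum_biUnion fun k _ k' _ hk => disjoint_left.2 fun w hw hw' => hk ?_
      rw [← length_of_mem_contWords hw, length_of_mem_contWords hw']
    have hSsum : ∑ w ∈ S, wordWeight w = 1 + z * t * ∑ w ∈ T, wordWeight w := by
      rw [hS, sum_insert (by simp), sum_image fun _ _ _ _ h => List.cons_injective h, mul_sum]
      congr 1
      · simp [wordWeight]
      · refine sum_congr rfl fun w _ => ?_
        rw [wordWeight_cons, letterWeight, if_pos rfl]
        ring
    rw [sum_congr rfl fun w hw => Set.indicator_of_mem (hS' w hw) f, hf, ← map_sum, hSsum, hTsum,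
      ← sub_eq_zero, ← map_sub, add_sub_add_left_eq_sub, ← mul_sub]
    refine coeff_eq_zero_of_t_pow_dvd (n := d 0 + 1) ?_ (Nat.lt_succ_self _)
    rw [← dvd_neg, ← mul_neg, neg_sub]
    exact (t_pow_dvd_contSeries_sub (d 0 + 1) (Nat.zero_le p)).mul_left _
  rw [← hsum]
  exact hasSum_sum_of_ne_finset_zero hzero

end Words

end PAscent

theorem mainTheorem1 (p : ℕ) (hp : 1 ≤ p) :
    Summable (PAscent.weight p) ∧ Summable (PAscent.term p) ∧
      PAscent.A p = 1 + ∑' n : ℕ, PAscent.term p n := by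
  refine ⟨(PAscent.hasSum_weight p).summable, PAscent.summable_term p, ?_⟩
  rw [PAscent.A, (PAscent.hasSum_weight p).tsum_eq, PAscent.z_mul_t_mul_contSeries_eq_tsum hp]
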